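/- Proposition (Posterior covariance bound). Let $n\ge 1$ and let $\Sigma_m,\Sigma_w\in\mathbb{R}^{n\times n}$ be symmetric positive definite. Let $m\sim\mathcal N(0,\Sigma_m)$ and $w\sim\mathcal N(0,\Sigma_w)$ be independent random vectors in $\mathbb{R}^n$ on a probability space. Let $\gamma:\mathbb{R}^n\to\mathbb{R}^n$ be any Borel-measurable map (the encoder policy), and put $x=\gamma(m)$ (transmitted signal), $P=\mathbb{E}\|x\|^2\in[0,\infty]$ (transmission power, with $\|\cdot\|$ the Euclidean norm), $y=x+w$ (channel output), $u=\mathbb{E}[m\mid y]$ (posterior mean) and $\Sigma_u=\mathbb{E}[uu^\top]$ (posterior mean covariance). Then $u$ is square-integrable, so that $\Sigma_u$ is well defined, and $$\operatorname{Tr}(\Sigma_u)\;\le\;\operatorname{Tr}(\Sigma_m)-n^2\,|\Sigma_m|^{1/n}\,|\Sigma_w|^{1/n}\,\bigl(P+\operatorname{Tr}(\Sigma_w)\bigr)^{-1},$$ where $|\cdot|$ denotes the determinant and $(P+\operatorname{Tr}(\Sigma_w))^{-1}=0$ if $P=\infty$. -/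

import Mathlib

open MeasureTheory ProbabilityTheory
open scoped ENNReal

namespace GaussianSignaling

variable {Ω : Type*} [MeasurableSpace Ω] {n : ℕ}

/-- The channel output `y = γ(m) + w`, for the encoder policy `γ`, the source `m` and the
channel noise `w`. -/
def channelOutput (γ : EuclideanSpace ℝ (Fin n) → EuclideanSpace ℝ (Fin n))
    (m w : Ω → EuclideanSpace ℝ (Fin n)) : Ω → EuclideanSpace ℝ (Fin n) :=
  fun ω => γ (m ω) + w ω

/-- The transmission power `P = 𝔼 ‖γ(m)‖²`, an element of `[0, ∞]`. -/
noncomputable def transmissionPower (μ : Measure Ω)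
    (γ : EuclideanSpace ℝ (Fin n) → EuclideanSpace ℝ (Fin n))
    (m : Ω → EuclideanSpace ℝ (Fin n)) : ℝ≥0∞ :=
  ∫⁻ ω, ENNReal.ofReal (‖γ (m ω)‖ ^ 2) ∂μ

/-- The posterior mean `u = 𝔼[m | y]`: the conditional expectation of the source given the
σ-algebra generated by the channel output. -/
noncomputable def posteriorMean (μ : Measure Ω)
    (γ : EuclideanSpace ℝ (Fin n) → EuclideanSpace ℝ (Fin n))
    (m w : Ω → EuclideanSpace ℝ (Fin n)) : Ω → EuclideanSpace ℝ (Fin n) :=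
  μ[m | MeasurableSpace.comap (channelOutput γ m w) inferInstance]

/-- The posterior mean covariance `Σ_u = 𝔼[u uᵀ]`. -/
noncomputable def posteriorMeanCov (μ : Measure Ω)
    (γ : EuclideanSpace ℝ (Fin n) → EuclideanSpace ℝ (Fin n))
    (m w : Ω → EuclideanSpace ℝ (Fin n)) : Matrix (Fin n) (Fin n) ℝ :=
  Matrix.of fun i j => ∫ ω, posteriorMean μ γ m w ω i * posteriorMean μ γ m w ω j ∂μ

end GaussianSignaling

/-! The bound is nonnegativity of a relative entropy. Write `y = γ(m) + w`, `u = U(y)`, `D = 𝔼‖m -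
u‖²` and `Q = 𝔼‖y‖² = P + Tr Σ_w`. Compare the true density of `(m, y)` at `(a, b)` with the
Gaussian test density `𝒩(a; U(b), d I) 𝒩(b; 0, s I)`. Their ratio has mean one under the true law;
with normalising constants moved across, this is `lintegral_exp_logRatio`. The remaining exponent
has mean `n/2 + n/2 - D/(2d) - Q/(2s)`, which is nonnegative once `D ≤ n d` and `Q ≤ n s`, so Jensen
gives `|Σ_m| |Σ_w| ≤ (d s)^n` (`det_mul_det_le_pow`).

Choosing `d`, `s` optimally yields `n² |Σ_m|^{1/n} |Σ_w|^{1/n} ≤ D Q` (`det_rpow_mul_det_rpow_le`),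
and orthogonality of conditional expectation gives `D = Tr Σ_m - Tr Σ_u`. -/

namespace GaussianSignaling

/-! ### Lebesgue density of the standard Gaussian. -/

section StdGaussian

variable {E : Type*} [NormedAddCommGroup E] [InnerProductSpace ℝ E] [FiniteDimensional ℝ E]
  [MeasurableSpace E] [BorelSpace E]

lemma integrable_exp_neg_mul_norm_sq {b : ℝ} (hb : 0 < b) :
    Integrable (fun x : E => Real.exp (-b * ‖x‖ ^ 2)) := by
  have h := GaussianFourier.integrable_cexp_neg_mul_sq_norm_add (V := E) (b := b)
    (by simpa using hb) 0 0
  convert h.norm using 2 with x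
  simp [Complex.norm_exp, ← Complex.ofReal_pow, ← Complex.ofReal_mul]

lemma lintegral_exp_neg_norm_sq_div {d : ℝ} (hd : 0 < d) :
    ∫⁻ x : E, ENNReal.ofReal (Real.exp (-(‖x‖ ^ 2 / (2 * d)))) =
      ENNReal.ofReal ((2 * Real.pi * d) ^ (Module.finrank ℝ E / 2 : ℝ)) := by
  have hb : 0 < (2 * d)⁻¹ := by positivity
  have h := integrable_exp_neg_mul_norm_sq (E := E) hb
  have h2 := GaussianFourier.integral_rexp_neg_mul_sq_norm (V := E) hb
  have e : (fun x : E => Real.exp (-(‖x‖ ^ 2 / (2 * d)))) =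
      fun x : E => Real.exp (-(2 * d)⁻¹ * ‖x‖ ^ 2) := by
    ext x; congr 1; field_simp
  rw [← ofReal_integral_eq_lintegral_ofReal (e ▸ h) (ae_of_all _ fun x => by positivity), e, h2]
  congr 2; field_simp

/-- Both sides are finite measures with the same characteristic function. -/
lemma stdGaussian_eq_withDensity :
    stdGaussian E = (volume : Measure E).withDensity fun x =>
      ENNReal.ofReal ((2 * Real.pi) ^ (-(Module.finrank ℝ E / 2 : ℝ)) *
        Real.exp (-(‖x‖ ^ 2 / 2))) := by
  set c : ℝ := (2 * Real.pi) ^ (-(Module.finrank ℝ E / 2 : ℝ)) with hc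
  have hint : Integrable (fun x : E => c * Real.exp (-(‖x‖ ^ 2 / 2))) := by
    convert (integrable_exp_neg_mul_norm_sq (E := E) (b := 1/2) (by norm_num)).const_mul c using 4
    ring
  have : IsFiniteMeasure ((volume : Measure E).withDensity fun x =>
      ENNReal.ofReal (c * Real.exp (-(‖x‖ ^ 2 / 2)))) :=
    isFiniteMeasure_withDensity_ofReal hint.2
  refine Measure.ext_of_charFun (E := E) ?_
  ext t
  rw [charFun_stdGaussian, charFun_apply,
    integral_withDensity_eq_integral_toReal_smul (by fun_prop) (by simp)]
  have h := GaussianFourier.integral_cexp_neg_mul_sq_norm_add (V := E) (b := 1 / 2)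
    (by norm_num) Complex.I t
  have e : ∀ x : E, (ENNReal.ofReal (c * Real.exp (-(‖x‖ ^ 2 / 2)))).toReal •
      Complex.exp (inner ℝ x t * Complex.I) =
      c * Complex.exp (-(1 / 2) * ‖x‖ ^ 2 + Complex.I * inner ℝ t x) := by
    intro x
    rw [ENNReal.toReal_ofReal (by positivity), Complex.exp_add, real_inner_comm]
    simp only [Complex.real_smul]
    push_cast
    rw [mul_assoc]
    congr 3
    · ring
    · rw [mul_comm]
  simp_rw [e]
  rw [integral_const_mul, h, ← mul_assoc]
  have e2 : (c : ℂ) * (Real.pi / (1 / 2)) ^ (Module.finrank ℝ E / 2 : ℂ) = 1 := by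
    have : ((Real.pi / (1 / 2) : ℂ)) ^ (Module.finrank ℝ E / 2 : ℂ) =
        (((2 * Real.pi) ^ (Module.finrank ℝ E / 2 : ℝ) : ℝ) : ℂ) := by
      rw [Complex.ofReal_cpow (by positivity)]
      push_cast
      congr 1
      ring
    rw [this, ← Complex.ofReal_mul, hc, ← Real.rpow_add (by positivity)]
    simp
  rw [e2, one_mul]
  congr 1
  rw [Complex.I_sq]
  ring

/-- The exponential weight cancels the Gaussian density, leaving only its normalising constant. -/
lemma lintegral_mul_exp_stdGaussian {F : E → ℝ≥0∞} (hF : Measurable F) :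
    ∫⁻ x, F x * ENNReal.ofReal (Real.exp (‖x‖ ^ 2 / 2)) ∂(stdGaussian E) =
      ENNReal.ofReal ((2 * Real.pi) ^ (-(Module.finrank ℝ E / 2 : ℝ))) * ∫⁻ x, F x := by
  rw [stdGaussian_eq_withDensity, lintegral_withDensity_eq_lintegral_mul _ (by fun_prop)
    (by fun_prop), ← lintegral_const_mul _ hF]
  refine lintegral_congr fun x => ?_
  simp only [Pi.mul_apply]
  rw [mul_left_comm, ← ENNReal.ofReal_mul (by positivity), mul_assoc, ← Real.exp_add]
  simp [mul_comm]

end StdGaussian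

/-- Total mass of the unnormalised test density. Integrating in `a` first, translation invariance
removes `U b`, so measurability of `U` suffices. -/
lemma lintegral_lintegral_gaussian_shear {ι : Type*} [Fintype ι]
    {U : EuclideanSpace ℝ ι → EuclideanSpace ℝ ι}
    (hU : Measurable U) {d s : ℝ} (hd : 0 < d) (hs : 0 < s) :
    ∫⁻ a, ∫⁻ b, ENNReal.ofReal (Real.exp (-(‖a - U b‖ ^ 2 / (2 * d)))) *
        ENNReal.ofReal (Real.exp (-(‖b‖ ^ 2 / (2 * s)))) =
      ENNReal.ofReal ((2 * Real.pi * d) ^ (Fintype.card ι / 2 : ℝ)) *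
        ENNReal.ofReal ((2 * Real.pi * s) ^ (Fintype.card ι / 2 : ℝ)) := by
  rw [lintegral_lintegral_swap (by fun_prop)]
  have h : ∀ b, ∫⁻ a, ENNReal.ofReal (Real.exp (-(‖a - U b‖ ^ 2 / (2 * d)))) *
        ENNReal.ofReal (Real.exp (-(‖b‖ ^ 2 / (2 * s)))) =
      ENNReal.ofReal ((2 * Real.pi * d) ^ (Fintype.card ι / 2 : ℝ)) *
        ENNReal.ofReal (Real.exp (-(‖b‖ ^ 2 / (2 * s)))) := fun b => by
    rw [lintegral_mul_const _ (by fun_prop),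
      lintegral_sub_right_eq_self (fun a : EuclideanSpace ℝ ι =>
        ENNReal.ofReal (Real.exp (-(‖a‖ ^ 2 / (2 * d))))) (U b),
      lintegral_exp_neg_norm_sq_div hd, finrank_euclideanSpace]
  simp_rw [h]
  rw [lintegral_const_mul _ (by fun_prop), lintegral_exp_neg_norm_sq_div hs,
    finrank_euclideanSpace]

/-! ### Whitening and exponential moments of Gaussian vectors. -/

section Whitening

open scoped MatrixOrder

variable {ι : Type*} [Fintype ι] [DecidableEq ι]

/-- The linear map `S^{-1/2}`, which takes `𝒩(0, S)` to the standard Gaussian. -/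
noncomputable def whitening (S : Matrix ι ι ℝ) : EuclideanSpace ℝ ι →L[ℝ] EuclideanSpace ℝ ι :=
  Matrix.toEuclideanCLM (𝕜 := ℝ) (CFC.sqrt S)⁻¹

variable {S : Matrix ι ι ℝ}

lemma det_sqrt_of_posDef (hS : S.PosDef) : (CFC.sqrt S).det = √S.det := by
  rw [hS.posSemidef.det_sqrt, RCLike.sqrt_of_nonneg hS.posSemidef.det_nonneg]
  simp

lemma whitening_toEuclideanCLM_sqrt (hS : S.PosDef) (x : EuclideanSpace ℝ ι) :
    whitening S (Matrix.toEuclideanCLM (𝕜 := ℝ) (CFC.sqrt S) x) = x := by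
  have hu : IsUnit (CFC.sqrt S).det := by
    rw [det_sqrt_of_posDef hS]
    exact (Real.sqrt_pos.2 hS.det_pos).ne'.isUnit
  have h : whitening S * Matrix.toEuclideanCLM (𝕜 := ℝ) (CFC.sqrt S) = 1 := by
    rw [whitening, ← map_mul, Matrix.nonsing_inv_mul _ hu, map_one]
  exact congrArg (fun T => T x) h

lemma map_whitening_multivariateGaussian (hS : S.PosDef) :
    (multivariateGaussian 0 S).map (whitening S) = stdGaussian (EuclideanSpace ℝ ι) := by
  rw [multivariateGaussian, Measure.map_map (by fun_prop) (by fun_prop)]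
  simp [Function.comp_def, whitening_toEuclideanCLM_sqrt hS]

/-- Substituting `x = S^{1/2} z` reduces to the standard Gaussian; the Jacobian contributes
`(√S.det)⁻¹`. -/
lemma lintegral_mul_exp_whitening (hS : S.PosDef) {F : EuclideanSpace ℝ ι → ℝ≥0∞}
    (hF : Measurable F) :
    ∫⁻ x, F x * ENNReal.ofReal (Real.exp (‖whitening S x‖ ^ 2 / 2)) ∂(multivariateGaussian 0 S) =
      ENNReal.ofReal ((2 * Real.pi) ^ (-(Fintype.card ι / 2 : ℝ)) * (√S.det)⁻¹) * ∫⁻ x, F x := by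
  have hdet : LinearMap.det ((Matrix.toEuclideanCLM (𝕜 := ℝ) (CFC.sqrt S) :
      EuclideanSpace ℝ ι →L[ℝ] EuclideanSpace ℝ ι) :
      EuclideanSpace ℝ ι →ₗ[ℝ] EuclideanSpace ℝ ι) = √S.det := by
    rw [Matrix.coe_toEuclideanCLM_eq_toEuclideanLin, ← det_sqrt_of_posDef hS]
    exact LinearMap.det_toLpLin 2 _
  have hpos : 0 < √S.det := Real.sqrt_pos.2 hS.det_pos
  have hmap := Measure.map_linearMap_addHaar_eq_smul_addHaar
    (volume : Measure (EuclideanSpace ℝ ι)) (hdet.trans_ne hpos.ne')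
  rw [hdet, abs_of_pos (by positivity)] at hmap
  rw [multivariateGaussian, lintegral_map (by fun_prop) (by fun_prop)]
  simp only [zero_add, whitening_toEuclideanCLM_sqrt hS]
  rw [lintegral_mul_exp_stdGaussian
    (F := fun x => F (Matrix.toEuclideanCLM (𝕜 := ℝ) (CFC.sqrt S) x)) (by fun_prop),
    ENNReal.ofReal_mul (by positivity), mul_assoc, finrank_euclideanSpace]
  congr 1
  rw [← smul_eq_mul, ← lintegral_smul_measure, ← hmap, lintegral_map hF (by fun_prop)]
  rfl

lemma integral_norm_sq_multivariateGaussian (hS : S.PosSemidef) :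
    ∫ x, ‖x‖ ^ 2 ∂(multivariateGaussian 0 S) = S.trace := by
  have hL : ∀ i, MemLp (fun x : EuclideanSpace ℝ ι => x i) 2 (multivariateGaussian 0 S) :=
    fun i => (EuclideanSpace.proj i : EuclideanSpace ℝ ι →L[ℝ] ℝ).comp_memLp'
      IsGaussian.memLp_two_id
  simp_rw [EuclideanSpace.real_norm_sq_eq]
  rw [integral_finsetSum _ fun i _ => (hL i).integrable_sq, Matrix.trace]
  refine Finset.sum_congr rfl fun i _ => ?_
  rw [Matrix.diag_apply, ← variance_eval_multivariateGaussian (μ := 0) hS i,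
    variance_of_integral_eq_zero (hL i).aestronglyMeasurable.aemeasurable]
  have h := (EuclideanSpace.proj i : EuclideanSpace ℝ ι →L[ℝ] ℝ).integral_comp_id_comm
    (μ := multivariateGaussian 0 S) IsGaussian.integrable_id
  simpa using h

lemma integral_norm_sq_stdGaussian :
    ∫ x, ‖x‖ ^ 2 ∂(stdGaussian (EuclideanSpace ℝ ι)) = Fintype.card ι := by
  rw [← multivariateGaussian_zero_one, integral_norm_sq_multivariateGaussian Matrix.PosSemidef.one]
  simp

lemma integral_norm_sq_whitening (hS : S.PosDef) :
    ∫ x, ‖whitening S x‖ ^ 2 ∂(multivariateGaussian 0 S) = Fintype.card ι := by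
  rw [← integral_norm_sq_stdGaussian, ← map_whitening_multivariateGaussian hS,
    integral_map (by fun_prop) (by fun_prop)]

/-- Once the weights have turned both Gaussians into Lebesgue measure, the shear `(a, c) ↦ (a, γ a +
c)` preserves the integral and the encoder disappears. -/
lemma lintegral_prod_mul_exp_whitening {S T : Matrix ι ι ℝ} (hS : S.PosDef) (hT : T.PosDef)
    {γ : EuclideanSpace ℝ ι → EuclideanSpace ℝ ι} (hγ : Measurable γ)
    {G : EuclideanSpace ℝ ι × EuclideanSpace ℝ ι → ℝ≥0∞} (hG : Measurable G) :
    ∫⁻ p, G (p.1, γ p.1 + p.2) * ENNReal.ofReal (Real.exp (‖whitening T p.2‖ ^ 2 / 2)) *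
        ENNReal.ofReal (Real.exp (‖whitening S p.1‖ ^ 2 / 2))
      ∂((multivariateGaussian 0 S).prod (multivariateGaussian 0 T)) =
    ENNReal.ofReal ((2 * Real.pi) ^ (-(Fintype.card ι / 2 : ℝ)) * (√S.det)⁻¹) *
      (ENNReal.ofReal ((2 * Real.pi) ^ (-(Fintype.card ι / 2 : ℝ)) * (√T.det)⁻¹) *
        ∫⁻ a, ∫⁻ b, G (a, b)) := by
  have hm : Measurable fun a => ∫⁻ b, G (a, b) := hG.lintegral_prod_right'
  rw [lintegral_prod _ (by fun_prop), ← lintegral_const_mul _ hm,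
    ← lintegral_mul_exp_whitening hS (hm.const_mul _)]
  refine lintegral_congr fun a => ?_
  dsimp only
  rw [lintegral_mul_const' _ _ ENNReal.ofReal_ne_top,
    lintegral_mul_exp_whitening hT (F := fun c => G (a, γ a + c)) (by fun_prop),
    lintegral_add_left_eq_self (fun b => G (a, b)) (γ a)]

/-- The exponential moment of the log-likelihood ratio of a Gaussian test channel. -/
lemma lintegral_exp_logRatio {S T : Matrix ι ι ℝ} (hS : S.PosDef) (hT : T.PosDef)
    {γ U : EuclideanSpace ℝ ι → EuclideanSpace ℝ ι} (hγ : Measurable γ) (hU : Measurable U)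
    {d s : ℝ} (hd : 0 < d) (hs : 0 < s) :
    ∫⁻ p, ENNReal.ofReal (Real.exp (‖whitening S p.1‖ ^ 2 / 2 + ‖whitening T p.2‖ ^ 2 / 2
        - ‖p.1 - U (γ p.1 + p.2)‖ ^ 2 / (2 * d) - ‖γ p.1 + p.2‖ ^ 2 / (2 * s)))
      ∂((multivariateGaussian 0 S).prod (multivariateGaussian 0 T)) =
    ENNReal.ofReal √((d * s) ^ Fintype.card ι / (S.det * T.det)) := by
  let G : EuclideanSpace ℝ ι × EuclideanSpace ℝ ι → ℝ≥0∞ := fun q =>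
    ENNReal.ofReal (Real.exp (-(‖q.1 - U q.2‖ ^ 2 / (2 * d)))) *
      ENNReal.ofReal (Real.exp (-(‖q.2‖ ^ 2 / (2 * s))))
  have hG : Measurable G := by fun_prop
  have hsplit : ∀ p : EuclideanSpace ℝ ι × EuclideanSpace ℝ ι,
      ENNReal.ofReal (Real.exp (‖whitening S p.1‖ ^ 2 / 2 + ‖whitening T p.2‖ ^ 2 / 2
        - ‖p.1 - U (γ p.1 + p.2)‖ ^ 2 / (2 * d) - ‖γ p.1 + p.2‖ ^ 2 / (2 * s))) =
      G (p.1, γ p.1 + p.2) * ENNReal.ofReal (Real.exp (‖whitening T p.2‖ ^ 2 / 2)) *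
        ENNReal.ofReal (Real.exp (‖whitening S p.1‖ ^ 2 / 2)) := fun p => by
    simp only [G]
    rw [← ENNReal.ofReal_mul (by positivity), ← ENNReal.ofReal_mul (by positivity),
      ← ENNReal.ofReal_mul (by positivity), ← Real.exp_add, ← Real.exp_add, ← Real.exp_add]
    congr 2
    ring
  rw [lintegral_congr hsplit, lintegral_prod_mul_exp_whitening hS hT hγ hG,
    lintegral_lintegral_gaussian_shear hU hd hs, ← ENNReal.ofReal_mul (by positivity),
    ← ENNReal.ofReal_mul (by positivity), ← ENNReal.ofReal_mul (by positivity)]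
  congr 1
  have hSd := hS.det_pos
  have hTd := hT.det_pos
  rw [Real.sqrt_div (by positivity), Real.sqrt_mul hSd.le, Real.mul_rpow (by positivity) hd.le,
    Real.mul_rpow (by positivity) hs.le, Real.rpow_neg (by positivity)]
  have hpow : √((d * s) ^ Fintype.card ι) =
      d ^ (Fintype.card ι / 2 : ℝ) * s ^ (Fintype.card ι / 2 : ℝ) := by
    rw [← Real.mul_rpow hd.le hs.le, Real.sqrt_eq_rpow, ← Real.rpow_natCast,
      ← Real.rpow_mul (by positivity)]
    congr 1
    ring
  rw [hpow]
  have : 0 < (2 * Real.pi) ^ (Fintype.card ι / 2 : ℝ) := by positivity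
  have : 0 < √S.det := Real.sqrt_pos.2 hSd
  have : 0 < √T.det := Real.sqrt_pos.2 hTd
  field_simp

end Whitening

/-! ### Second moments and orthogonality of conditional expectation. -/

section SquareIntegrable

variable {Ω E : Type*} [NormedAddCommGroup E] {mΩ : MeasurableSpace Ω} {μ : Measure Ω}

lemma integrable_norm_sq_of_memLp_two {X : Ω → E} (hX : MemLp X 2 μ) :
    Integrable (fun ω => ‖X ω‖ ^ 2) μ :=
  (memLp_two_iff_integrable_sq_norm hX.aestronglyMeasurable).1 hX

lemma integrable_inner_of_memLp_two [InnerProductSpace ℝ E] {X Y : Ω → E}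
    (hX : MemLp X 2 μ) (hY : MemLp Y 2 μ) :
    Integrable (fun ω => inner ℝ (X ω) (Y ω)) μ := by
  refine (hX.norm.integrable_mul hY.norm).mono
    (hX.aestronglyMeasurable.inner hY.aestronglyMeasurable) (ae_of_all _ fun ω => ?_)
  simpa using abs_real_inner_le_norm (X ω) (Y ω)

end SquareIntegrable

section CondExp

variable {Ω E : Type*} [NormedAddCommGroup E] [InnerProductSpace ℝ E] [CompleteSpace E]
  {F : MeasurableSpace Ω} {mΩ : MeasurableSpace Ω} {μ : Measure Ω} [IsProbabilityMeasure μ]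

lemma integral_norm_sub_condExp_sq (hF : F ≤ mΩ) {X : Ω → E} (hX : MemLp X 2 μ) :
    ∫ ω, ‖X ω - μ[X | F] ω‖ ^ 2 ∂μ = ∫ ω, ‖X ω‖ ^ 2 ∂μ - ∫ ω, ‖μ[X | F] ω‖ ^ 2 ∂μ := by
  have hU : MemLp (μ[X | F]) 2 μ := hX.condExp (by norm_num)
  have hXU := integrable_inner_of_memLp_two hU hX
  have hcross : ∫ ω, inner ℝ (μ[X | F] ω) (X ω) ∂μ = ∫ ω, ‖μ[X | F] ω‖ ^ 2 ∂μ := by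
    rw [← integral_condExp hF]
    refine integral_congr_ae ?_
    -- Pull-out property for the inner product: `μ[X | F]` is already `F`-measurable.
    filter_upwards [condExp_bilin_of_stronglyMeasurable_left (m := F) (innerSL ℝ)
      stronglyMeasurable_condExp hXU (hX.integrable (by norm_num))] with ω hω
    rw [← real_inner_self_eq_norm_sq]
    exact hω
  have hexp : ∀ ω, ‖X ω - μ[X | F] ω‖ ^ 2 =
      ‖X ω‖ ^ 2 - 2 * inner ℝ (μ[X | F] ω) (X ω) + ‖μ[X | F] ω‖ ^ 2 := fun ω => by
    rw [norm_sub_sq_real, real_inner_comm]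
  have hXi := integrable_norm_sq_of_memLp_two hX
  have hUi := integrable_norm_sq_of_memLp_two hU
  have hsub : Integrable (fun ω => ‖X ω‖ ^ 2 - 2 * inner ℝ (μ[X | F] ω) (X ω)) μ :=
    hXi.sub (hXU.const_mul 2)
  simp_rw [hexp]
  rw [integral_add hsub hUi, integral_sub hXi (hXU.const_mul 2), integral_const_mul, hcross]
  ring

end CondExp

/-! ### Moments of the source, the noise and the transmitted signal. -/

section Moments

variable {Ω : Type*} [MeasurableSpace Ω] {μ : Measure Ω} {n : ℕ}

lemma memLp_two_apply {X : Ω → EuclideanSpace ℝ (Fin n)} (hX : MemLp X 2 μ) (i : Fin n) :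
    MemLp (fun ω => X ω i) 2 μ :=
  (EuclideanSpace.proj i : EuclideanSpace ℝ (Fin n) →L[ℝ] ℝ).comp_memLp' hX

lemma integral_norm_add_sq_of_indepFun [IsProbabilityMeasure μ]
    {X W : Ω → EuclideanSpace ℝ (Fin n)}
    (hX : MemLp X 2 μ) (hW : MemLp W 2 μ) (hXW : IndepFun X W μ) (hW0 : ∫ ω, W ω ∂μ = 0) :
    ∫ ω, ‖X ω + W ω‖ ^ 2 ∂μ = ∫ ω, ‖X ω‖ ^ 2 ∂μ + ∫ ω, ‖W ω‖ ^ 2 ∂μ := by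
  have hW0i : ∀ i, ∫ ω, W ω i ∂μ = 0 := fun i => by
    have h := (EuclideanSpace.proj i : EuclideanSpace ℝ (Fin n) →L[ℝ] ℝ).integral_comp_comm
      (hW.integrable (by norm_num))
    simpa [hW0] using h
  have hcross : ∫ ω, inner ℝ (X ω) (W ω) ∂μ = 0 := by
    simp only [PiLp.inner_apply]
    rw [integral_finsetSum _ fun i _ => ?_]
    · refine Finset.sum_eq_zero fun i _ => ?_
      have hi : IndepFun (fun ω => X ω i) (fun ω => W ω i) μ :=
        hXW.comp (φ := fun x : EuclideanSpace ℝ (Fin n) => x i)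
          (ψ := fun x : EuclideanSpace ℝ (Fin n) => x i) (by fun_prop) (by fun_prop)
      have := hi.symm.integral_fun_mul_eq_mul_integral
        (memLp_two_apply hW i).aestronglyMeasurable (memLp_two_apply hX i).aestronglyMeasurable
      simpa [hW0i i] using this
    · simpa [Pi.mul_def] using (memLp_two_apply hW i).integrable_mul (memLp_two_apply hX i)
  have hXi := integrable_norm_sq_of_memLp_two hX
  have hWi := integrable_norm_sq_of_memLp_two hW
  have hXW' := integrable_inner_of_memLp_two hX hW
  have hadd : Integrable (fun ω => ‖X ω‖ ^ 2 + 2 * inner ℝ (X ω) (W ω)) μ :=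
    hXi.add (hXW'.const_mul 2)
  simp_rw [norm_add_sq_real]
  rw [integral_add hadd hWi, integral_add hXi (hXW'.const_mul 2), integral_const_mul, hcross]
  ring

lemma trace_posteriorMeanCov {γ : EuclideanSpace ℝ (Fin n) → EuclideanSpace ℝ (Fin n)}
    {m w : Ω → EuclideanSpace ℝ (Fin n)} (hU : MemLp (posteriorMean μ γ m w) 2 μ) :
    (posteriorMeanCov μ γ m w).trace = ∫ ω, ‖posteriorMean μ γ m w ω‖ ^ 2 ∂μ := by
  simp_rw [EuclideanSpace.real_norm_sq_eq]
  rw [integral_finsetSum _ fun i _ => (memLp_two_apply hU i).integrable_sq]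
  simp [Matrix.trace, posteriorMeanCov, sq]

lemma memLp_two_of_map_eq {X : Ω → EuclideanSpace ℝ (Fin n)} (hX : Measurable X)
    {S : Matrix (Fin n) (Fin n) ℝ} (hlaw : μ.map X = multivariateGaussian 0 S) : MemLp X 2 μ := by
  have h : MemLp id 2 (μ.map X) := hlaw ▸ IsGaussian.memLp_two_id
  exact (memLp_map_measure_iff (by fun_prop) hX.aemeasurable).1 h

lemma integral_comp_of_map_eq {X : Ω → EuclideanSpace ℝ (Fin n)} (hX : Measurable X)
    {S : Matrix (Fin n) (Fin n) ℝ} (hlaw : μ.map X = multivariateGaussian 0 S)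
    {f : EuclideanSpace ℝ (Fin n) → ℝ} (hf : Measurable f) :
    ∫ ω, f (X ω) ∂μ = ∫ x, f x ∂(multivariateGaussian 0 S) := by
  rw [← hlaw, integral_map hX.aemeasurable hf.aestronglyMeasurable]

lemma memLp_transmitted {γ : EuclideanSpace ℝ (Fin n) → EuclideanSpace ℝ (Fin n)}
    {m : Ω → EuclideanSpace ℝ (Fin n)} (hγ : Measurable γ) (hm : Measurable m)
    (hP : transmissionPower μ γ m ≠ ∞) : MemLp (fun ω => γ (m ω)) 2 μ := by
  refine (memLp_two_iff_integrable_sq_norm (hγ.comp hm).aestronglyMeasurable).2 ?_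
  exact (lintegral_ofReal_ne_top_iff_integrable
    ((hγ.comp hm).norm.pow_const 2).aestronglyMeasurable
    (ae_of_all _ fun ω => by positivity)).1 hP

lemma transmissionPower_eq_ofReal {γ : EuclideanSpace ℝ (Fin n) → EuclideanSpace ℝ (Fin n)}
    {m : Ω → EuclideanSpace ℝ (Fin n)} (hγm : MemLp (fun ω => γ (m ω)) 2 μ) :
    transmissionPower μ γ m = ENNReal.ofReal (∫ ω, ‖γ (m ω)‖ ^ 2 ∂μ) :=
  (ofReal_integral_eq_lintegral_ofReal
    (integrable_norm_sq_of_memLp_two hγm)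
    (ae_of_all _ fun ω => by positivity)).symm

end Moments

/-- Jensen's inequality for `exp`; finiteness of the lower integral supplies the integrability it
needs. -/
lemma exp_integral_le_of_lintegral_exp {Ω : Type*} [MeasurableSpace Ω] {μ : Measure Ω}
    [IsProbabilityMeasure μ] {L : Ω → ℝ} (hL : Integrable L μ) {c : ℝ} (hc : 0 ≤ c)
    (h : ∫⁻ ω, ENNReal.ofReal (Real.exp (L ω)) ∂μ = ENNReal.ofReal c) :
    Real.exp (∫ ω, L ω ∂μ) ≤ c := by
  have hpos : 0 ≤ᵐ[μ] fun ω => Real.exp (L ω) := ae_of_all _ fun ω => by positivity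
  have hmeas : AEStronglyMeasurable (fun ω => Real.exp (L ω)) μ :=
    Real.continuous_exp.comp_aestronglyMeasurable hL.aestronglyMeasurable
  have hint : Integrable (fun ω => Real.exp (L ω)) μ :=
    (lintegral_ofReal_ne_top_iff_integrable hmeas hpos).1 (h ▸ ENNReal.ofReal_ne_top)
  have hle := convexOn_exp.map_integral_le Real.continuous_exp.continuousOn isClosed_univ
    (ae_of_all _ fun _ => Set.mem_univ _) hL hint
  rwa [integral_eq_lintegral_of_nonneg_ae hpos hmeas, h, ENNReal.toReal_ofReal hc] at hle

/-! ### The determinant inequality and the choice of variances. -/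

section Main

variable {Ω : Type*} [MeasurableSpace Ω] {μ : Measure Ω} [IsProbabilityMeasure μ] {n : ℕ}

lemma det_mul_det_le_pow {Sm Sw : Matrix (Fin n) (Fin n) ℝ} (hSm : Sm.PosDef) (hSw : Sw.PosDef)
    {m w : Ω → EuclideanSpace ℝ (Fin n)} (hm : Measurable m) (hw : Measurable w)
    (hm_law : μ.map m = multivariateGaussian 0 Sm)
    (hw_law : μ.map w = multivariateGaussian 0 Sw) (hmw : IndepFun m w μ)
    {γ U : EuclideanSpace ℝ (Fin n) → EuclideanSpace ℝ (Fin n)} (hγ : Measurable γ)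
    (hU : Measurable U) (hγm : MemLp (fun ω => γ (m ω)) 2 μ)
    (hUy : MemLp (fun ω => U (γ (m ω) + w ω)) 2 μ) {d s : ℝ} (hd : 0 < d) (hs : 0 < s)
    (hD : ∫ ω, ‖m ω - U (γ (m ω) + w ω)‖ ^ 2 ∂μ ≤ n * d)
    (hY : ∫ ω, ‖γ (m ω)‖ ^ 2 ∂μ + Sw.trace ≤ n * s) :
    Sm.det * Sw.det ≤ (d * s) ^ n := by
  have hm2 := memLp_two_of_map_eq hm hm_law
  have hw2 := memLp_two_of_map_eq hw hw_law
  have hw0 : ∫ ω, w ω ∂μ = 0 := by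
    have h := integral_map (f := id) hw.aemeasurable (μ := μ) (by fun_prop)
    rw [hw_law] at h
    simpa using h.symm
  have hy2 : ∫ ω, ‖γ (m ω) + w ω‖ ^ 2 ∂μ ≤ n * s := by
    rw [integral_norm_add_sq_of_indepFun hγm hw2 (hmw.comp hγ measurable_id) hw0,
      integral_comp_of_map_eq hw hw_law (f := fun x => ‖x‖ ^ 2) (by fun_prop),
      integral_norm_sq_multivariateGaussian hSw.posSemidef]
    exact hY
  have hwm : ∫ ω, ‖whitening Sm (m ω)‖ ^ 2 ∂μ = n := by
    rw [integral_comp_of_map_eq hm hm_law (f := fun x => ‖whitening Sm x‖ ^ 2) (by fun_prop),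
      integral_norm_sq_whitening hSm, Fintype.card_fin]
  have hww : ∫ ω, ‖whitening Sw (w ω)‖ ^ 2 ∂μ = n := by
    rw [integral_comp_of_map_eq hw hw_law (f := fun x => ‖whitening Sw x‖ ^ 2) (by fun_prop),
      integral_norm_sq_whitening hSw, Fintype.card_fin]
  have i1 := (integrable_norm_sq_of_memLp_two ((whitening Sm).comp_memLp' hm2)).div_const 2
  have i2 := (integrable_norm_sq_of_memLp_two ((whitening Sw).comp_memLp' hw2)).div_const 2
  have i3 := (integrable_norm_sq_of_memLp_two (hm2.sub hUy)).div_const (2 * d)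
  have i4 := (integrable_norm_sq_of_memLp_two (hγm.add hw2)).div_const (2 * s)
  have hlint := lintegral_exp_logRatio hSm hSw hγ hU hd hs
  -- Independence identifies the product of the Gaussian laws with the joint law of `(m, w)`, so the
  -- exponential moment moves to `Ω`.
  rw [← hm_law, ← hw_law, ← (indepFun_iff_map_prod_eq_prod_map_map hm.aemeasurable
    hw.aemeasurable).1 hmw, lintegral_map (by fun_prop) (by fun_prop)] at hlint
  have hJ := exp_integral_le_of_lintegral_exp (((i1.add i2).sub i3).sub i4) (Real.sqrt_nonneg _)
    hlint
  have hEL := integral_sub ((i1.add i2).sub i3) i4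
  rw [integral_sub' (i1.add i2) i3, integral_add' i1 i2] at hEL
  simp only [Function.comp_apply, Pi.sub_apply, Pi.add_apply, integral_div] at hEL hJ
  rw [hwm, hww] at hEL
  have hge : (1 : ℝ) ≤ √((d * s) ^ Fintype.card (Fin n) / (Sm.det * Sw.det)) := by
    refine le_trans ?_ hJ
    -- The whitened terms contribute `n/2` each, and each subtracted term is at most `n/2`.
    refine Real.one_le_exp ?_
    have h1 : (∫ ω, ‖m ω - U (γ (m ω) + w ω)‖ ^ 2 ∂μ) / (2 * d) ≤ n / 2 := by
      rw [div_le_iff₀ (by positivity)]; linarith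
    have h2 : (∫ ω, ‖γ (m ω) + w ω‖ ^ 2 ∂μ) / (2 * s) ≤ n / 2 := by
      rw [div_le_iff₀ (by positivity)]; linarith
    linarith
  have hdet := mul_pos hSm.det_pos hSw.det_pos
  rw [Real.one_le_sqrt, le_div_iff₀ hdet, Fintype.card_fin, one_mul] at hge
  exact hge

lemma det_rpow_mul_det_rpow_le {Sm Sw : Matrix (Fin n) (Fin n) ℝ} (hSm : Sm.PosDef)
    (hSw : Sw.PosDef) (hn : 1 ≤ n) {D Q : ℝ} (hD : 0 ≤ D) (hQ : 0 < Q)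
    (h : ∀ d s : ℝ, 0 < d → 0 < s → D ≤ n * d → Q ≤ n * s → Sm.det * Sw.det ≤ (d * s) ^ n) :
    (n : ℝ) ^ 2 * Sm.det ^ (1 / (n : ℝ)) * Sw.det ^ (1 / (n : ℝ)) ≤ D * Q := by
  have hn0 : (0 : ℝ) < n := by exact_mod_cast hn
  -- The optimal choice is `d = D / n`, `s = Q / n`, but `D = 0` is not yet excluded and `d` must be
  -- positive; hence `D' > D`, followed by a limit.
  have hmul : ∀ D', D < D' →
      (n : ℝ) ^ 2 * Sm.det ^ (1 / (n : ℝ)) * Sw.det ^ (1 / (n : ℝ)) ≤ D' * Q := fun D' hD' => by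
    have hD'0 : 0 < D' := hD.trans_lt hD'
    have hdet := h (D' / n) (Q / n) (by positivity) (by positivity)
      (by rw [mul_div_cancel₀ _ hn0.ne']; exact hD'.le) (by rw [mul_div_cancel₀ _ hn0.ne'])
    have hroot := Real.rpow_le_rpow (mul_pos hSm.det_pos hSw.det_pos).le hdet
      (by positivity : 0 ≤ 1 / (n : ℝ))
    rw [one_div, Real.pow_rpow_inv_natCast (by positivity) (by lia), ← one_div,
      Real.mul_rpow hSm.det_pos.le hSw.det_pos.le] at hroot
    calc (n : ℝ) ^ 2 * Sm.det ^ (1 / (n : ℝ)) * Sw.det ^ (1 / (n : ℝ))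
        = (n : ℝ) ^ 2 * (Sm.det ^ (1 / (n : ℝ)) * Sw.det ^ (1 / (n : ℝ))) := by ring
      _ ≤ (n : ℝ) ^ 2 * (D' / n * (Q / n)) := by gcongr
      _ = D' * Q := by field_simp
  rw [← div_le_iff₀ hQ]
  exact le_of_forall_gt_imp_ge_of_dense fun D' hD' => (div_le_iff₀ hQ).2 (hmul D' hD')

end Main

end GaussianSignaling

open GaussianSignaling in
theorem mainTheorem6 {Ω : Type*} [MeasurableSpace Ω] (μ : Measure Ω) [IsProbabilityMeasure μ]
    (n : ℕ) (hn : 1 ≤ n)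
    (Sm Sw : Matrix (Fin n) (Fin n) ℝ) (hSm : Sm.PosDef) (hSw : Sw.PosDef)
    (m w : Ω → EuclideanSpace ℝ (Fin n)) (hm : Measurable m) (hw : Measurable w)
    (hm_law : μ.map m = multivariateGaussian 0 Sm)
    (hw_law : μ.map w = multivariateGaussian 0 Sw)
    (hmw : IndepFun m w μ)
    (γ : EuclideanSpace ℝ (Fin n) → EuclideanSpace ℝ (Fin n)) (hγ : Measurable γ) :
    MemLp (GaussianSignaling.posteriorMean μ γ m w) 2 μ ∧
    (GaussianSignaling.posteriorMeanCov μ γ m w).trace ≤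
      Sm.trace - (n : ℝ) ^ 2 * Sm.det ^ (1 / (n : ℝ)) * Sw.det ^ (1 / (n : ℝ)) *
        ((GaussianSignaling.transmissionPower μ γ m + ENNReal.ofReal Sw.trace)⁻¹).toReal := by
  have hm2 := memLp_two_of_map_eq hm hm_law
  have hu2 : MemLp (posteriorMean μ γ m w) 2 μ := hm2.condExp (by norm_num)
  have hy : Measurable (channelOutput γ m w) := (hγ.comp hm).add hw
  have hmse : ∫ ω, ‖m ω - posteriorMean μ γ m w ω‖ ^ 2 ∂μ =
      Sm.trace - (posteriorMeanCov μ γ m w).trace := by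
    rw [trace_posteriorMeanCov hu2, ← integral_norm_sq_multivariateGaussian hSm.posSemidef,
      ← integral_comp_of_map_eq hm hm_law (f := fun x => ‖x‖ ^ 2) (by fun_prop)]
    exact integral_norm_sub_condExp_sq hy.comap_le hm2
  have hmse0 : 0 ≤ Sm.trace - (posteriorMeanCov μ γ m w).trace :=
    hmse ▸ integral_nonneg fun ω => by positivity
  refine ⟨hu2, ?_⟩
  by_cases hP : transmissionPower μ γ m = ∞
  -- With infinite power the inverse is `0`, and only nonnegativity of the mean square error
  -- remains.
  · simpa [hP] using hmse0
  have hγm := memLp_transmitted hγ hm hP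
  -- Doob–Dynkin: the posterior mean is a measurable function of the channel output, which serves as
  -- the centre of the test channel.
  obtain ⟨U, hU, hUy⟩ := StronglyMeasurable.exists_eq_measurable_comp
    (f := channelOutput γ m w) (g := posteriorMean μ γ m w) stronglyMeasurable_condExp
  have hUω : posteriorMean μ γ m w = fun ω => U (γ (m ω) + w ω) := hUy
  have : Nonempty (Fin n) := ⟨⟨0, hn⟩⟩
  have hQ : 0 < ∫ ω, ‖γ (m ω)‖ ^ 2 ∂μ + Sw.trace :=
    add_pos_of_nonneg_of_pos (integral_nonneg fun ω => by positivity) hSw.trace_pos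
  have hbound := det_rpow_mul_det_rpow_le hSm hSw hn hmse0 hQ fun d s hd hs hD hY =>
    det_mul_det_le_pow hSm hSw hm hw hm_law hw_law hmw hγ hU.measurable hγm (hUω ▸ hu2) hd hs
      ((hUω ▸ hmse.le).trans hD) hY
  rw [transmissionPower_eq_ofReal hγm,
    ← ENNReal.ofReal_add (integral_nonneg fun ω => by positivity) hSw.posSemidef.trace_nonneg,
    ENNReal.toReal_inv, ENNReal.toReal_ofReal hQ.le, ← div_eq_mul_inv]
  have := (div_le_iff₀ hQ).2 hbound
  linarith
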